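/- Let $N\ge 2$ and let $A=(a_{ij})$ be an $N\times N$ transition matrix, that is, a matrix with entries in $\{0,1\}$ having at least one entry equal to $1$ in every row and in every column. Put $\rho(A)=\lim_{n\to\infty}\|A^n\|^{1/n}$, where $\|B\|=\sum_{i,j}b_{ij}$. Let $(X,d)$ be a compact metric space and let $f_n:X\to X$, $n\ge 0$, be continuous maps. Write $f_0^0=\mathrm{id}$ and $f_0^n=f_{n-1}\circ\cdots\circ f_0$, and $f_0^{-n}(S)$ for the preimage of $S$ under $f_0^n$. Suppose that the system $f_{0,\infty}=(f_n)_{n\ge 0}$ is weakly $A$-coupled-expanding in compact sets $V_{i,n}$ $(1\le i\le N,\ n\ge 0)$, that is, the $V_{i,n}$ are nonempty compact subsets of $X$ with $V_{i,n}\cap V_{j,n}=\partial V_{i,n}\cap\partial V_{j,n}$ for all $i\ne j$ and $n\ge 0$, and $$f_n(V_{i,n})\supset\bigcup_{j:\,a_{ij}=1}V_{j,n+1}\qquad(1\le i\le N,\ n\ge 0).$$ Suppose moreover that there are pairwise disjoint nonempty closed sets $V_1,\dots,V_N\subset X$ with $V_{i,n}\subset V_i$ for all $i$ and $n$. Then the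 topological entropy of the whole system satisfies $$h(f_{0,\infty})\ \ge\ \log\rho(A).$$ Here $h(f_{0,\infty})=\sup_{\mathcal A}\limsup_{n\to\infty}\frac1n\log\mathcal N(\mathcal A_0^n)\in[0,\infty]$, the supremum is over all open covers $\mathcal A$ of $X$, $\mathcal A_0^n=\{\bigcap_{j=0}^{n-1}f_0^{-j}(A_j):A_0,\dots,A_{n-1}\in\mathcal A\}$, and $\mathcal N(\mathcal B)$ is the minimal cardinality of a subcover of a cover $\mathcal B$ of $X$. -/

import Mathlib

open Set Filter Topology

namespace NonautonomousSystem

/-! ### Transition matrices and the number `ρ(A)` -/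

/-- A transition matrix: an `N × N` matrix with `N ≥ 2`, entries in `{0, 1}`, and at least one
entry `1` in every row and in every column. -/
structure IsTransitionMatrix {N : ℕ} (A : Matrix (Fin N) (Fin N) ℝ) : Prop where
  two_le : 2 ≤ N
  zero_or_one : ∀ i j, A i j = 0 ∨ A i j = 1
  row_sum : ∀ i, 1 ≤ ∑ j, A i j
  col_sum : ∀ j, 1 ≤ ∑ i, A i j

/-- `‖A‖ = ∑_{i,j} a_{ij}`. -/
def entrySum {N : ℕ} (A : Matrix (Fin N) (Fin N) ℝ) : ℝ := ∑ i, ∑ j, A i j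

/-- `ρ(A) = lim_{n → ∞} ‖A ^ n‖ ^ (1 / n)`. For a transition matrix the limit exists:
see `IsTransitionMatrix.tendsto_rho`. -/
noncomputable def rho {N : ℕ} (A : Matrix (Fin N) (Fin N) ℝ) : ℝ :=
  limUnder atTop fun n : ℕ => entrySum (A ^ n) ^ (1 / (n : ℝ))

theorem entrySum_mul_le {N : ℕ} {A B : Matrix (Fin N) (Fin N) ℝ} (hA : ∀ i j, 0 ≤ A i j)
    (hB : ∀ i j, 0 ≤ B i j) : entrySum (A * B) ≤ entrySum A * entrySum B := by
  unfold entrySum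
  rw [Finset.sum_mul]
  refine Finset.sum_le_sum fun i _ => ?_
  simp only [Matrix.mul_apply]
  rw [Finset.sum_comm, Finset.sum_mul]
  refine Finset.sum_le_sum fun k _ => ?_
  rw [← Finset.mul_sum]
  refine mul_le_mul_of_nonneg_left ?_ (hA i k)
  exact Finset.single_le_sum (f := fun k => ∑ j, B k j)
    (fun k _ => Finset.sum_nonneg fun j _ => hB k j) (Finset.mem_univ k)

theorem IsTransitionMatrix.pow_nonneg {N : ℕ} {A : Matrix (Fin N) (Fin N) ℝ}
    (hA : IsTransitionMatrix A) (n : ℕ) : ∀ i j, 0 ≤ (A ^ n) i j := by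
  induction n with
  | zero => intro i j; rw [pow_zero, Matrix.one_apply]; split_ifs <;> norm_num
  | succ n ih =>
    intro i j
    rw [pow_succ, Matrix.mul_apply]
    refine Finset.sum_nonneg fun k _ => mul_nonneg (ih i k) ?_
    rcases hA.zero_or_one k j with h | h <;> simp [h]

theorem IsTransitionMatrix.one_le_entrySum_pow {N : ℕ} {A : Matrix (Fin N) (Fin N) ℝ}
    (hA : IsTransitionMatrix A) (n : ℕ) : 1 ≤ entrySum (A ^ n) := by
  have hrow : ∀ n : ℕ, ∀ i, 1 ≤ ∑ j, (A ^ n) i j := by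
    intro n
    induction n with
    | zero => intro i; simp [Matrix.one_apply]
    | succ n ih =>
      intro i
      simp only [pow_succ, Matrix.mul_apply]
      rw [Finset.sum_comm]
      refine (ih i).trans (Finset.sum_le_sum fun k _ => ?_)
      rw [← Finset.mul_sum]
      exact le_mul_of_one_le_right (hA.pow_nonneg n i k) (hA.row_sum k)
  have i₀ : Fin N := ⟨0, by have := hA.two_le; omega⟩
  exact (hrow n i₀).trans (Finset.single_le_sum (f := fun i => ∑ j, (A ^ n) i j)
    (fun i _ => Finset.sum_nonneg fun j _ => hA.pow_nonneg n i j) (Finset.mem_univ i₀))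

/-- The limit that defines `ρ(A)` exists for every transition matrix. -/
theorem IsTransitionMatrix.tendsto_rho {N : ℕ} {A : Matrix (Fin N) (Fin N) ℝ}
    (hA : IsTransitionMatrix A) :
    Tendsto (fun n : ℕ => entrySum (A ^ n) ^ (1 / (n : ℝ))) atTop (𝓝 (rho A)) := by
  have hpos : ∀ n, 0 < entrySum (A ^ n) := fun n =>
    zero_lt_one.trans_le (hA.one_le_entrySum_pow n)
  have hsub : Subadditive fun n : ℕ => Real.log (entrySum (A ^ n)) := by
    intro m n
    change Real.log (entrySum (A ^ (m + n))) ≤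
      Real.log (entrySum (A ^ m)) + Real.log (entrySum (A ^ n))
    rw [← Real.log_mul (hpos m).ne' (hpos n).ne', pow_add]
    refine Real.log_le_log ?_ (entrySum_mul_le (hA.pow_nonneg m) (hA.pow_nonneg n))
    rw [← pow_add]
    exact hpos _
  have hbdd : BddBelow (range fun n : ℕ => Real.log (entrySum (A ^ n)) / n) := by
    refine ⟨0, ?_⟩
    rintro _ ⟨n, rfl⟩
    exact div_nonneg (Real.log_nonneg (hA.one_le_entrySum_pow n)) n.cast_nonneg
  have hlim := (Real.continuous_exp.tendsto _).comp (hsub.tendsto_lim hbdd)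
  refine tendsto_nhds_limUnder ⟨_, hlim.congr fun n => ?_⟩
  rw [Real.rpow_def_of_pos (hpos n)]
  simp [div_eq_mul_inv]

/-! ### Topological entropy of a non-autonomous system -/

/-- `f_i^n = f_{i+n-1} ∘ ⋯ ∘ f_i`, with `f_i^0 = id`. -/
def iter {X : Type*} (f : ℕ → X → X) (i : ℕ) : ℕ → X → X
  | 0 => id
  | n + 1 => f (i + n) ∘ iter f i n

/-- `𝒜_0^n = {⋂_{j < n} f_0^{-j}(A_j) : A_j ∈ 𝒜}`. -/
def refinedCover {X : Type*} (f : ℕ → X → X) (𝒜 : Set (Set X)) (n : ℕ) : Set (Set X) :=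
  {S | ∃ a : Fin n → Set X, (∀ j, a j ∈ 𝒜) ∧ S = ⋂ j : Fin n, iter f 0 j ⁻¹' a j}

/-- The cover `𝒜|_Y = {A ∩ Y : A ∈ 𝒜}` of `Y`. -/
def traceCover {X : Type*} (𝒜 : Set (Set X)) (Y : Set X) : Set (Set X) :=
  (fun A => A ∩ Y) '' 𝒜

/-- The minimal cardinality of a subfamily of `𝒜` that covers `Y`. -/
noncomputable def minCoverCard {X : Type*} (Y : Set X) (𝒜 : Set (Set X)) : ℕ∞ :=
  ⨅ (ℬ : Set (Set X)) (_ : ℬ ⊆ 𝒜) (_ : Y ⊆ ⋃₀ ℬ), ℬ.encard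

/-- The topological entropy `h(f_{0,∞}, Y)` on `Y`: the supremum, over all open covers `𝒜` of `X`,
of `limsup_{n → ∞} (log 𝒩(𝒜_0^n|_Y)) / n`. -/
noncomputable def topEntropyOn {X : Type*} [TopologicalSpace X] (f : ℕ → X → X) (Y : Set X) :
    EReal :=
  ⨆ (𝒜 : Set (Set X)) (_ : ∀ U ∈ 𝒜, IsOpen U) (_ : ⋃₀ 𝒜 = univ),
    limsup (fun n : ℕ =>
      ENNReal.log (minCoverCard Y (traceCover (refinedCover f 𝒜 n) Y) : ENNReal) / (n : EReal))
      atTop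

/-- The topological entropy `h(f_{0,∞}) = h(f_{0,∞}, X)` of the whole system. -/
noncomputable def topEntropy {X : Type*} [TopologicalSpace X] (f : ℕ → X → X) : EReal :=
  topEntropyOn f univ

/-! ### Weak coupled-expansion -/

/-- The system `(f_n)` is weakly `A`-coupled-expanding in the sets `V i n = V_{i,n}`. -/
structure IsWeaklyCoupledExpanding {X : Type*} [TopologicalSpace X] {N : ℕ}
    (A : Matrix (Fin N) (Fin N) ℝ) (f : ℕ → X → X) (V : Fin N → ℕ → Set X) : Prop where
  nonempty : ∀ i n, (V i n).Nonempty
  inter_eq : ∀ i j n, i ≠ j → V i n ∩ V j n = frontier (V i n) ∩ frontier (V j n)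
  expanding : ∀ i n, ⋃ (j : Fin N) (_ : A i j = 1), V j (n + 1) ⊆ f n '' V i n

end NonautonomousSystem

namespace NonautonomousSystem

/-! The sum `entrySum (A ^ n)` counts the admissible words with `n` transitions. By the expanding
inclusions, pulling points back one map at a time realises each word by an orbit
(`exists_separated`), and distinct words give points that lie in different, hence disjoint, `W i` at
some time `k ≤ n`. A member of `disjointPiecesCover W` meets at most one `W i`, so a member of its
refinement over the times `0, …, n` contains at most one of these points. Hence every subcover of
that refinement has at least `entrySum (A ^ n)` members, and the growth rate of this bound is `log
ρ(A)`. -/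

theorem iter_succ_left {X : Type*} (f : ℕ → X → X) (m k : ℕ) (x : X) :
    iter f m (k + 1) x = iter f (m + 1) k (f m x) := by
  induction k with
  | zero => simp [iter]
  | succ k ih =>
    rw [iter, Function.comp_apply, ih, iter, Function.comp_apply]
    congr 1
    omega

/-- Two points are told apart by their itineraries through the sets `W i` up to time `n`. -/
def ItinerarySeparated {X ι : Type*} (f : ℕ → X → X) (W : ι → Set X) (m n : ℕ) (x y : X) : Prop :=
  ∃ k ≤ n, ∃ a b, a ≠ b ∧ iter f m k x ∈ W a ∧ iter f m k y ∈ W b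

theorem ItinerarySeparated.of_apply {X ι : Type*} {f : ℕ → X → X} {W : ι → Set X} {m n : ℕ}
    {x y : X} (h : ItinerarySeparated f W (m + 1) n (f m x) (f m y)) :
    ItinerarySeparated f W m (n + 1) x y := by
  obtain ⟨k, hk, a, b, hab, hx, hy⟩ := h
  exact ⟨k + 1, by omega, a, b, hab, by rwa [iter_succ_left], by rwa [iter_succ_left]⟩

/-- Separated sets in pairwise disjoint pieces `V i ⊆ W i` unite to a separated set whose
cardinality is the sum of the cardinalities. -/
theorem exists_separated_union {X ι : Type*} {f : ℕ → X → X} {W V : ι → Set X}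
    (hW : ∀ i j, i ≠ j → Disjoint (W i) (W j)) (hVW : ∀ i, V i ⊆ W i) {m n : ℕ}
    (S : ι → Finset X) (hSV : ∀ i, ∀ x ∈ S i, x ∈ V i)
    (hS : ∀ i, ∀ x ∈ S i, ∀ y ∈ S i, x ≠ y → ItinerarySeparated f W m n x y) (J : Finset ι) :
    ∃ T : Finset X, T.card = ∑ i ∈ J, (S i).card ∧ (∀ x ∈ T, ∃ i ∈ J, x ∈ V i) ∧
      ∀ x ∈ T, ∀ y ∈ T, x ≠ y → ItinerarySeparated f W m n x y := by
  classical
  refine ⟨J.biUnion S, Finset.card_biUnion fun i _ j _ hij => ?_, fun x hx => ?_,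
    fun x hx y hy hxy => ?_⟩
  · exact Finset.disjoint_left.2 fun x hi hj =>
      Set.disjoint_left.1 (hW i j hij) (hVW i (hSV i x hi)) (hVW j (hSV j x hj))
  · obtain ⟨i, hi, hx⟩ := Finset.mem_biUnion.1 hx
    exact ⟨i, hi, hSV i x hx⟩
  · obtain ⟨i, _, hx⟩ := Finset.mem_biUnion.1 hx
    obtain ⟨j, _, hy⟩ := Finset.mem_biUnion.1 hy
    by_cases hij : i = j
    · subst hij
      exact hS i x hx y hy hxy
    · exact ⟨0, n.zero_le, i, j, hij, hVW i (hSV i x hx), hVW j (hSV j y hy)⟩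

section Separated

variable {X : Type*} [TopologicalSpace X] {N : ℕ} {A : Matrix (Fin N) (Fin N) ℝ}
  {f : ℕ → X → X} {V : Fin N → ℕ → Set X} {W : Fin N → Set X}

/-- Induction on `n` through `A ^ (n + 1) = A * A ^ n`: the sets obtained at time `m + 1` for the
successors `j` of `i` are united and lifted through `f m` into `V i m`. Separation of the images
passes to the lifts, one time step later. -/
theorem IsWeaklyCoupledExpanding.exists_separated_row (hA : IsTransitionMatrix A)
    (hexp : IsWeaklyCoupledExpanding A f V) (hW : ∀ i j, i ≠ j → Disjoint (W i) (W j))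
    (hVW : ∀ i n, V i n ⊆ W i) (n : ℕ) :
    ∀ m i, ∃ S : Finset X, (S.card : ℝ) = ∑ j, (A ^ n) i j ∧ (∀ x ∈ S, x ∈ V i m) ∧
      ∀ x ∈ S, ∀ y ∈ S, x ≠ y → ItinerarySeparated f W m n x y := by
  classical
  induction n with
  | zero =>
    intro m i
    obtain ⟨x, hx⟩ := hexp.nonempty i m
    refine ⟨{x}, by simp [Matrix.one_apply], by simpa using hx, fun a ha b hb hab => ?_⟩
    rw [Finset.mem_singleton] at ha hb
    exact absurd (ha.trans hb.symm) hab
  | succ n ih =>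
    intro m i
    choose S hcard hSV hS using ih (m + 1)
    obtain ⟨T, hTcard, hTV, hT⟩ := exists_separated_union hW (fun i => hVW i (m + 1)) S hSV hS
      (Finset.univ.filter fun j => A i j = 1)
    have hpre : ∀ y ∈ T, ∃ x, x ∈ V i m ∧ f m x = y := by
      intro y hy
      obtain ⟨j, hj, hyj⟩ := hTV y hy
      refine hexp.expanding i m ?_
      simp only [mem_iUnion]
      exact ⟨j, (Finset.mem_filter.1 hj).2, hyj⟩
    choose! g hgV hg using hpre
    have hinj : Set.InjOn g T := fun a ha b hb hab => by rw [← hg a ha, hab, hg b hb]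
    refine ⟨T.image g, ?_, ?_, ?_⟩
    · rw [Finset.card_image_of_injOn hinj, hTcard, Nat.cast_sum, Finset.sum_filter]
      simp only [pow_succ', Matrix.mul_apply]
      rw [Finset.sum_comm]
      refine Finset.sum_congr rfl fun j _ => ?_
      rw [← Finset.mul_sum, ← hcard j]
      rcases hA.zero_or_one i j with h | h <;> simp [h]
    · intro x hx
      obtain ⟨y, hy, rfl⟩ := Finset.mem_image.1 hx
      exact hgV y hy
    · intro x hx x' hx' hne
      obtain ⟨y, hy, rfl⟩ := Finset.mem_image.1 hx
      obtain ⟨y', hy', rfl⟩ := Finset.mem_image.1 hx'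
      refine ItinerarySeparated.of_apply ?_
      rw [hg y hy, hg y' hy']
      exact hT y hy y' hy' fun h => hne (by rw [h])

theorem IsWeaklyCoupledExpanding.exists_separated (hA : IsTransitionMatrix A)
    (hexp : IsWeaklyCoupledExpanding A f V) (hW : ∀ i j, i ≠ j → Disjoint (W i) (W j))
    (hVW : ∀ i n, V i n ⊆ W i) (n : ℕ) :
    ∃ S : Finset X, (S.card : ℝ) = entrySum (A ^ n) ∧
      ∀ x ∈ S, ∀ y ∈ S, x ≠ y → ItinerarySeparated f W 0 n x y := by
  choose S hcard hSV hS using hexp.exists_separated_row hA hW hVW n 0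
  obtain ⟨T, hTcard, -, hT⟩ := exists_separated_union hW (fun i => hVW i 0) S hSV hS Finset.univ
  exact ⟨T, by simp [hTcard, hcard, entrySum], hT⟩

end Separated

/-- The cover of `X` by the sets `X \ ⋃_{j ≠ i} W_j`. -/
def disjointPiecesCover {X ι : Type*} (W : ι → Set X) : Set (Set X) :=
  range fun i => ⋂ (j : ι) (_ : j ≠ i), (W j)ᶜ

theorem isOpen_of_mem_disjointPiecesCover {X ι : Type*} [TopologicalSpace X] [Finite ι]
    {W : ι → Set X} (hW : ∀ i, IsClosed (W i)) : ∀ U ∈ disjointPiecesCover W, IsOpen U := by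
  rintro _ ⟨i, rfl⟩
  exact isOpen_iInter_of_finite fun j => isOpen_iInter_of_finite fun _ => (hW j).isOpen_compl

theorem sUnion_disjointPiecesCover {X ι : Type*} [Nonempty ι] {W : ι → Set X}
    (hW : ∀ i j, i ≠ j → Disjoint (W i) (W j)) : ⋃₀ disjointPiecesCover W = univ := by
  refine eq_univ_of_forall fun x => ?_
  obtain ⟨i, hi⟩ : ∃ i, ∀ j, j ≠ i → x ∉ W j := by
    by_cases h : ∃ i, x ∈ W i
    · obtain ⟨i, hi⟩ := h
      exact ⟨i, fun j hj hx => Set.disjoint_left.1 (hW j i hj) hx hi⟩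
    -- A point outside every `W j` lies in all members of the cover.
    · exact ⟨Classical.arbitrary ι, fun j _ hx => h ⟨j, hx⟩⟩
  exact mem_sUnion.2 ⟨_, ⟨i, rfl⟩, by simpa using hi⟩

/-- If no member of `𝒜` contains two points of `S ⊆ Y`, then covering `Y` takes at least `|S|`
members of `𝒜`. -/
theorem card_le_minCoverCard {X : Type*} {Y : Set X} {𝒜 : Set (Set X)} (S : Finset X)
    (hSY : ∀ x ∈ S, x ∈ Y) (h : ∀ U ∈ 𝒜, ∀ x ∈ S, ∀ y ∈ S, x ∈ U → y ∈ U → x = y) :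
    (S.card : ℕ∞) ≤ minCoverCard Y 𝒜 := by
  refine le_iInf fun ℬ => le_iInf fun hℬ => le_iInf fun hY => ?_
  have hmem : ∀ x ∈ S, ∃ U ∈ ℬ, x ∈ U := fun x hx => hY (hSY x hx)
  choose! u huB hu using hmem
  have hinj : Set.InjOn u S := fun x hx y hy hxy =>
    h _ (hℬ (huB x hx)) x hx y hy (hu x hx) (hxy ▸ hu y hy)
  rw [← Set.encard_coe_eq_coe_finsetCard, ← hinj.encard_image]
  exact Set.encard_le_encard (by rintro _ ⟨x, hx, rfl⟩; exact huB x hx)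

/-- At each time `k ≤ n` the factor of `U` avoids all `W j` except one `W i`, so both orbits can
only visit that same piece. -/
theorem eq_of_mem_refinedCover {X ι : Type*} {f : ℕ → X → X} {W : ι → Set X} {n : ℕ} {U : Set X}
    (hU : U ∈ refinedCover f (disjointPiecesCover W) (n + 1)) {x y : X} (hx : x ∈ U) (hy : y ∈ U) :
    ¬ ItinerarySeparated f W 0 n x y := by
  rintro ⟨k, hk, a, b, hab, hxa, hyb⟩
  obtain ⟨c, hc, rfl⟩ := hU
  obtain ⟨i, hi⟩ := hc ⟨k, Nat.lt_succ_of_le hk⟩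
  have hx' := mem_iInter.1 hx ⟨k, Nat.lt_succ_of_le hk⟩
  have hy' := mem_iInter.1 hy ⟨k, Nat.lt_succ_of_le hk⟩
  rw [← hi] at hx' hy'
  simp only [mem_preimage, mem_iInter, mem_compl_iff] at hx' hy'
  have ha : a = i := by_contra fun h => hx' a h hxa
  have hb : b = i := by_contra fun h => hy' b h hyb
  exact hab (ha.trans hb.symm)

theorem IsTransitionMatrix.one_le_rho {N : ℕ} {A : Matrix (Fin N) (Fin N) ℝ}
    (hA : IsTransitionMatrix A) : 1 ≤ rho A :=
  ge_of_tendsto' hA.tendsto_rho fun n =>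
    Real.one_le_rpow (hA.one_le_entrySum_pow n) (by positivity)

theorem IsTransitionMatrix.tendsto_log_entrySum_div {N : ℕ} {A : Matrix (Fin N) (Fin N) ℝ}
    (hA : IsTransitionMatrix A) :
    Tendsto (fun n : ℕ => Real.log (entrySum (A ^ n)) / ((n + 1 : ℕ) : ℝ)) atTop
      (𝓝 (Real.log (rho A))) := by
  -- The factor `n / (n + 1) → 1` turns division by `n` into division by `n + 1`.
  have h := (hA.tendsto_rho.log (zero_lt_one.trans_le hA.one_le_rho).ne').mul
    (tendsto_natCast_div_add_atTop (1 : ℝ))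
  rw [mul_one] at h
  refine h.congr' ?_
  filter_upwards [eventually_gt_atTop 0] with n hn
  have : (n : ℝ) ≠ 0 := by positivity
  rw [Real.log_rpow (zero_lt_one.trans_le (hA.one_le_entrySum_pow n))]
  push_cast
  field_simp

theorem coe_log_le_log_of_card_le {c : ℕ} {r : ℝ} {e : ℕ∞} (hr : 0 < r) (hc : (c : ℝ) = r)
    (h : (c : ℕ∞) ≤ e) : (Real.log r : EReal) ≤ ENNReal.log (e : ENNReal) := by
  have h1 : ENNReal.ofReal r ≤ (e : ENNReal) := by
    rw [← hc, ENNReal.ofReal_natCast]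
    exact_mod_cast h
  refine le_trans (le_of_eq ?_) (ENNReal.log_monotone h1)
  rw [ENNReal.log_ofReal_of_pos hr]

end NonautonomousSystem

open NonautonomousSystem in
theorem theorem3p8 {X : Type*} [MetricSpace X] [CompactSpace X] {N : ℕ}
    (A : Matrix (Fin N) (Fin N) ℝ) (hA : NonautonomousSystem.IsTransitionMatrix A)
    (f : ℕ → X → X) (hf : ∀ n, Continuous (f n))
    (V : Fin N → ℕ → Set X) (hVcompact : ∀ i n, IsCompact (V i n))
    (hexp : NonautonomousSystem.IsWeaklyCoupledExpanding A f V)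
    (W : Fin N → Set X) (hWne : ∀ i, (W i).Nonempty) (hWclosed : ∀ i, IsClosed (W i))
    (hWdisj : ∀ i j, i ≠ j → Disjoint (W i) (W j)) (hVW : ∀ i n, V i n ⊆ W i) :
    (Real.log (NonautonomousSystem.rho A) : EReal) ≤ NonautonomousSystem.topEntropy f := by
  have : Nonempty (Fin N) := ⟨⟨0, by have := hA.two_le; omega⟩⟩
  unfold topEntropy topEntropyOn
  refine le_iSup_of_le (disjointPiecesCover W) (le_iSup₂_of_le
    (isOpen_of_mem_disjointPiecesCover hWclosed) (sUnion_disjointPiecesCover hWdisj) ?_)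
  -- A word with `n` transitions occupies `n + 1` times, so `A ^ n` is compared with the cover
  -- refined `n + 1` times.
  rw [← limsup_nat_add _ 1]
  have hlim : Tendsto (fun n : ℕ =>
      ((Real.log (entrySum (A ^ n)) / ((n + 1 : ℕ) : ℝ) : ℝ) : EReal)) atTop
      (𝓝 (Real.log (rho A) : EReal)) :=
    (continuous_coe_real_ereal.tendsto _).comp hA.tendsto_log_entrySum_div
  rw [← hlim.limsup_eq]
  refine limsup_le_limsup (Eventually.of_forall fun n => ?_)
  obtain ⟨S, hcard, hS⟩ := hexp.exists_separated hA hWdisj hVW n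
  beta_reduce
  rw [EReal.coe_div, EReal.coe_natCast]
  refine EReal.div_le_div_right_of_nonneg (by positivity) (coe_log_le_log_of_card_le
    (zero_lt_one.trans_le (hA.one_le_entrySum_pow n)) hcard
    (card_le_minCoverCard S (fun x _ => mem_univ x) ?_))
  rintro _ ⟨U, hU, rfl⟩ x hx y hy hxU hyU
  by_contra hxy
  exact eq_of_mem_refinedCover hU hxU.1 hyU.1 (hS x hx y hy hxy)
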